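/- Let $G=P2/m$ be the crystallographic group with presentation $$G=\langle x,y,z,r,m \mid [x,y],\,[x,z],\,[y,z],\,r^2,\,m^2,\,(mr)^2,\ x^m=x,\ y^m=y^{-1},\ z^m=z,\ x^r=x^{-1},\ y^r=y,\ z^r=z^{-1}\rangle ,$$ where $g^h=h^{-1}gh$, and for $n\ge 1$ let $a_n$ denote the number of subgroups of index $n$ in $G$. Then $1\le a_n<\infty$ for every $n\ge1$, and $G$ has degree $3$, i.e. $$\limsup_{n\to\infty}\frac{\log a_n}{\log n}=3 .$$ In other words, $3$ is the smallest positive real number $c$ such that $a_n=O(n^{c+\varepsilon})$ for every $\varepsilon>0$. -/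

import Mathlib

open Filter Topology Asymptotics

/-- The five generators of the space group `P2/m`: the translations `x, y, z`, the diad
rotation `r` and the reflection `m`. -/
inductive P2mGen : Type
  | x | y | z | r | m

open P2mGen commutatorElement in
/-- The defining relators of `P2/m`: a relation `u = v` is recorded as the relator `u * v⁻¹`,
`⁅g, h⁆` is the commutator, and the conjugate `g ^ h` is `h⁻¹ * g * h`. -/
def p2mRels : Set (FreeGroup P2mGen) :=
  let X := FreeGroup.of x
  let Y := FreeGroup.of y
  let Z := FreeGroup.of z
  let R := FreeGroup.of r
  let M := FreeGroup.of m
  { ⁅X, Y⁆, ⁅X, Z⁆, ⁅Y, Z⁆, R ^ 2, M ^ 2, (M * R) ^ 2,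
    (M⁻¹ * X * M) * X⁻¹,
    (M⁻¹ * Y * M) * (Y⁻¹)⁻¹,
    (M⁻¹ * Z * M) * Z⁻¹,
    (R⁻¹ * X * R) * (X⁻¹)⁻¹,
    (R⁻¹ * Y * R) * Y⁻¹,
    (R⁻¹ * Z * R) * (Z⁻¹)⁻¹ }

/-- The crystallographic group `P2/m`, given by its presentation. -/
abbrev P2m : Type := PresentedGroup p2mRels

/-- `a_n(G)`: the number of subgroups of index `n` in `G`. It is meant for `n ≥ 1` (in Mathlib
`H.index = 0` says that `H` has infinite index) and for groups with finitely many subgroups of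
index `n`. -/
noncomputable def subgroupCount (G : Type*) [Group G] (n : ℕ) : ℕ :=
  Set.ncard {H : Subgroup G | H.index = n}

/-- The degree of `G`: `limsup (log a_n(G) / log n)` as `n → ∞`, taken in the extended real
numbers, where every sequence has a limit superior. -/
noncomputable def subgroupGrowthDegree (G : Type*) [Group G] : EReal :=
  limsup (fun n : ℕ => ((Real.log (subgroupCount G n) / Real.log n : ℝ) : EReal)) atTop

/-! Upper bound. Let `N` be normal in `G` with `G / N` cyclic, generated by the class of `g`. A
subgroup `H` of index `n` is determined by `L = H ∩ N`, of index `d ∣ n` in `N`, and one coset of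
`L` in `N`, so `a_n(G) ≤ ∑_{d ∣ n} d * a_d(N)`. Each such extension costs one factor `n * (1 + log
n)`. From the exponent 0 for `ℤ` this gives 2 for the lattice `ℤ³`, and 3 for the kernels of the
three nontrivial sign characters `ρ`, `μ`, `ρμ`, each an extension of the lattice by a group of
order 2.

A further extension step would give exponent 4 for the whole group. Instead, a subgroup `H` in none
of the three kernels maps onto the point group. Then `P = H ∩ ker ρμ` has index `2n` and contains a
point inversion `s`, which acts as `-1` on the whole lattice. Two reflections extending `P` differ
by a translation `u`, and comparing their commutators with `s` forces `u² ∈ P`. A finite quotient of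
`ℤ³` has at most 8 elements killed by 2, so each `P` arises from at most 8 subgroups `H`, and the
exponent stays 3.

Lower bound. On `ker ρμ` one sign acts on all three coordinates, so every form `c - p a - q b`
modulo `k` gives a map onto the dihedral group of order `2k`. Pulling back the subgroups generated
by a reflection gives `k³` distinct subgroups of index `2k` in the whole group. -/

/-! ### Subgroups of extensions with cyclic quotient -/

namespace Subgroup

variable {G : Type*} [Group G]

/-- The second isomorphism theorem for indices: `[HN : H] = [N : H ∩ N]` for normal `N`. -/
theorem relIndex_sup_normal (H N : Subgroup G) [N.Normal] :
    H.relIndex (H ⊔ N) = H.relIndex N := by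
  symm
  refine Nat.card_congr (Equiv.ofBijective
    (quotientSubgroupOfEmbeddingOfLE H (le_sup_right : N ≤ H ⊔ N)) ⟨?_, ?_⟩)
  · exact (quotientSubgroupOfEmbeddingOfLE H (le_sup_right : N ≤ H ⊔ N)).injective
  · intro q
    induction q using QuotientGroup.induction_on with
    | H z =>
      obtain ⟨z, hz⟩ := z
      rw [sup_comm] at hz
      obtain ⟨ν, hν, h, hh, rfl⟩ := mem_sup_of_normal_left.1 hz
      refine ⟨QuotientGroup.mk ⟨ν, hν⟩, ?_⟩
      rw [quotientSubgroupOfEmbeddingOfLE_apply_mk, QuotientGroup.eq]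
      simpa [mem_subgroupOf] using hh

/-- In a group whose quotient by the image of `ι` is generated by the class of `g`, the powers of
`g` in a subgroup containing that image are those whose exponent is divisible by the index. -/
theorem zpow_mem_iff_index_dvd {N : Type*} [Group N] (ι : N →* G) [ι.range.Normal] (g : G)
    (hg : ∀ x : G, ∃ j : ℤ, ∃ ν : N, x = g ^ j * ι ν) (P : Subgroup G) (hP : ι.range ≤ P)
    (j : ℤ) : g ^ j ∈ P ↔ (P.index : ℤ) ∣ j := by
  have hgen : ∀ x : G, (x : G ⧸ ι.range) ∈ zpowers (g : G ⧸ ι.range) := by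
    intro x
    obtain ⟨j, ν, rfl⟩ := hg x
    refine ⟨j, ?_⟩
    change (g : G ⧸ ι.range) ^ j = _
    rw [← QuotientGroup.mk_zpow, QuotientGroup.eq]
    simp
  -- The quotient by `ι.range` is cyclic, hence abelian, so every subgroup above `ι.range` is
  -- normal.
  have : P.Normal := by
    constructor
    intro p hp x
    have hc : ((x * p * x⁻¹ : G) : G ⧸ ι.range) = (p : G ⧸ ι.range) := by
      obtain ⟨i, hi⟩ := hgen x
      obtain ⟨k, hk⟩ := hgen p
      simp only at hi hk
      rw [QuotientGroup.mk_mul, QuotientGroup.mk_mul, QuotientGroup.mk_inv, ← hi, ← hk]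
      group
    rw [QuotientGroup.eq] at hc
    have h2 : p * ((x * p * x⁻¹)⁻¹ * p)⁻¹ ∈ P := mul_mem hp (inv_mem (hP hc))
    simpa [mul_assoc] using h2
  have hgenP : ∀ x : G ⧸ P, x ∈ zpowers (g : G ⧸ P) := by
    intro x
    induction x using QuotientGroup.induction_on with
    | H x =>
      obtain ⟨j, ν, rfl⟩ := hg x
      refine ⟨j, ?_⟩
      change (g : G ⧸ P) ^ j = _
      rw [← QuotientGroup.mk_zpow, QuotientGroup.eq]
      simpa using hP ⟨ν, rfl⟩
  rw [Subgroup.index, ← orderOf_eq_card_of_forall_mem_zpowers hgenP, orderOf_dvd_iff_zpow_eq_one,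
    ← QuotientGroup.mk_zpow, QuotientGroup.eq_one_iff]

/-- A subgroup `H` of finite index in an extension with cyclic quotient is generated by its
intersection with the kernel and one further element. -/
theorem exists_eq_closure_of_cyclic_extension {N : Type*} [Group N] (ι : N →* G)
    [ι.range.Normal] (g : G) (hg : ∀ x : G, ∃ j : ℤ, ∃ ν : N, x = g ^ j * ι ν)
    {n : ℕ} (hn : n ≠ 0) (H : Subgroup G) (hH : H.index = n) :
    (H.comap ι).index ∣ n ∧ ∃ c : N ⧸ H.comap ι,
      H = closure (ι '' (H.comap ι) ∪ {g ^ (n / (H.comap ι).index) * ι c.out}) := by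
  have hmul : (H.comap ι).index * (H ⊔ ι.range).index = n := by
    rw [index_comap, ← relIndex_sup_normal, relIndex_mul_index le_sup_left, hH]
  have hpos : 0 < (H.comap ι).index := by
    rcases Nat.eq_zero_or_pos (H.comap ι).index with h | h
    · simp [h] at hmul; omega
    · exact h
  refine ⟨⟨_, hmul.symm⟩, ?_⟩
  have he : n / (H.comap ι).index = (H ⊔ ι.range).index := by
    rw [← hmul, Nat.mul_div_cancel_left _ hpos]
  rw [he]
  set e := (H ⊔ ι.range).index with hedef
  have hpow := zpow_mem_iff_index_dvd ι g hg (H ⊔ ι.range) le_sup_right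
  have hge : g ^ e ∈ ι.range ⊔ H := by
    rw [sup_comm]
    simpa using (hpow e).2 dvd_rfl
  rw [sup_comm] at hge
  obtain ⟨h, hh, ν', ⟨ν, rfl⟩, hhν⟩ := mem_sup_of_normal_right.1 hge
  have hν : g ^ e * ι ν⁻¹ ∈ H := by
    rw [← hhν]; simpa using hh
  -- Passing to the chosen representative of the coset changes the element only by a factor from
  -- `H`.
  obtain ⟨l, hl⟩ := QuotientGroup.mk_out_eq_mul (H.comap ι) (ν⁻¹)
  have hk : g ^ e * ι (QuotientGroup.mk (s := H.comap ι) ν⁻¹).out ∈ H := by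
    rw [hl, map_mul, ← mul_assoc]
    exact mul_mem hν l.2
  refine ⟨QuotientGroup.mk ν⁻¹, le_antisymm ?_ ?_⟩
  · intro x hx
    set k := g ^ e * ι (QuotientGroup.mk (s := H.comap ι) ν⁻¹).out with hkdef
    obtain ⟨j, μ, hxj⟩ := hg x
    have hj : g ^ j ∈ H ⊔ ι.range := by
      have : g ^ j = x * (ι μ)⁻¹ := by rw [hxj]; group
      rw [this]
      exact mul_mem (mem_sup_left hx) (inv_mem (mem_sup_right ⟨μ, rfl⟩))
    obtain ⟨i, rfl⟩ := (hpow j).1 hj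
    have hquot : ((k ^ i : G) : G ⧸ ι.range) = (x : G ⧸ ι.range) := by
      have h1 : (k : G ⧸ ι.range) = (g ^ e : G) := by
        rw [eq_comm, QuotientGroup.eq, hkdef]; simp
      rw [QuotientGroup.mk_zpow, h1, ← QuotientGroup.mk_zpow, hxj, QuotientGroup.eq, zpow_mul]
      simp [hedef]
    rw [QuotientGroup.eq] at hquot
    obtain ⟨l', hl'⟩ := hquot
    have hl'H : l' ∈ H.comap ι := by
      rw [mem_comap, hl']
      exact mul_mem (inv_mem (zpow_mem hk i)) hx
    have hx' : x = k ^ i * ι l' := by rw [hl']; group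
    rw [hx']
    have hkc : k ∈ closure (ι '' (H.comap ι : Set N) ∪ {k}) := subset_closure (Or.inr rfl)
    exact mul_mem (zpow_mem hkc i) (subset_closure (Or.inl ⟨l', hl'H, rfl⟩))
  · rw [closure_le]
    rintro x (⟨l', hl', rfl⟩ | rfl)
    · exact hl'
    · exact hk

end Subgroup

/-- `HasSubgroupBound G B`: for every `n ≥ 1` there are at most `B n` subgroups of index `n`. -/
def HasSubgroupBound (G : Type*) [Group G] (B : ℕ → ℝ) : Prop :=
  ∀ n : ℕ, n ≠ 0 → {H : Subgroup G | H.index = n}.Finite ∧ (subgroupCount G n : ℝ) ≤ B n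

/-- The counting bound for extensions with cyclic quotient. -/
theorem finite_and_subgroupCount_le_of_cyclic_extension {G N : Type*} [Group G] [Group N]
    (ι : N →* G) [ι.range.Normal] (g : G) (hg : ∀ x : G, ∃ j : ℤ, ∃ ν : N, x = g ^ j * ι ν)
    (hfin : ∀ n : ℕ, n ≠ 0 → {L : Subgroup N | L.index = n}.Finite) {n : ℕ} (hn : n ≠ 0) :
    {H : Subgroup G | H.index = n}.Finite ∧
      subgroupCount G n ≤ ∑ d ∈ n.divisors, d * subgroupCount N d := by
  classical
  let D := Σ d : n.divisors, Σ L : {L : Subgroup N | L.index = d}, N ⧸ L.1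
  let F : D → Subgroup G := fun p =>
    Subgroup.closure (ι '' (p.2.1.1 : Set N) ∪ {g ^ (n / (p.1 : ℕ)) * ι p.2.2.out})
  have hd0 : ∀ d : n.divisors, (d : ℕ) ≠ 0 := fun d =>
    (Nat.pos_of_mem_divisors d.2).ne'
  have h1 : ∀ d : n.divisors, Finite {L : Subgroup N | L.index = d} := fun d =>
    (hfin d (hd0 d)).to_subtype
  have h2 : ∀ (d : n.divisors) (L : {L : Subgroup N | L.index = d}), Finite (N ⧸ L.1) := by
    intro d L
    apply Nat.finite_of_card_ne_zero
    have : Nat.card (N ⧸ L.1) = d := L.2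
    rw [this]; exact hd0 d
  have h3 : ∀ d : n.divisors, Finite (Σ L : {L : Subgroup N | L.index = d}, N ⧸ L.1) :=
    fun d => inferInstance
  have hD : Finite D := inferInstance
  have hsub : {H : Subgroup G | H.index = n} ⊆ Set.range F := by
    intro H hH
    obtain ⟨hdvd, c, hc⟩ := H.exists_eq_closure_of_cyclic_extension ι g hg hn hH
    exact ⟨⟨⟨_, Nat.mem_divisors.2 ⟨hdvd, hn⟩⟩, ⟨H.comap ι, rfl⟩, c⟩, hc.symm⟩
  refine ⟨(Set.finite_range F).subset hsub, ?_⟩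
  calc subgroupCount G n ≤ (Set.range F).ncard := Set.ncard_le_ncard hsub (Set.finite_range F)
    _ ≤ Nat.card D := Finite.card_range_le F
    _ = ∑ d : n.divisors, (d : ℕ) * subgroupCount N d := by
        rw [Nat.card_sigma]
        refine Finset.sum_congr rfl fun d _ => ?_
        have := Fintype.ofFinite {L : Subgroup N | L.index = d}
        rw [Nat.card_sigma, Finset.sum_congr rfl (fun L _ => (L.2 : Nat.card (N ⧸ L.1) = d))]
        rw [Finset.sum_const, smul_eq_mul, mul_comm, Finset.card_univ, ← Nat.card_eq_fintype_card,
          Nat.card_coe_set_eq, subgroupCount]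
    _ = ∑ d ∈ n.divisors, d * subgroupCount N d :=
        Finset.sum_coe_sort n.divisors (fun d => d * subgroupCount N d)

/-! ### Divisor sums and the exponent of iterated extensions -/

theorem sum_divisors_inv_le (n : ℕ) : ∑ d ∈ n.divisors, (d : ℝ)⁻¹ ≤ 1 + Real.log n := by
  refine le_trans ?_ (harmonic_le_one_add_log n)
  rw [harmonic_eq_sum_Icc, Rat.cast_sum]
  push_cast
  refine Finset.sum_le_sum_of_subset_of_nonneg ?_ fun _ _ _ => by positivity
  intro d hd
  exact Finset.mem_Icc.2 ⟨Nat.pos_of_mem_divisors hd, Nat.divisor_le hd⟩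

theorem sum_divisors_mul_pow_log_le (s n : ℕ) :
    ∑ d ∈ n.divisors, (d : ℝ) * ((d : ℝ) ^ s * (1 + Real.log d) ^ s) ≤
      (n : ℝ) ^ (s + 1) * (1 + Real.log n) ^ (s + 1) := by
  -- With `d = n / e`, the linear factor becomes `n * e⁻¹`, and everything else is bounded by its
  -- value at `n`. The sum of the `e⁻¹` supplies the extra logarithm.
  rw [← Nat.sum_div_divisors]
  calc _ ≤ ∑ e ∈ n.divisors, ((n : ℝ) ^ (s + 1) * (1 + Real.log n) ^ s) * (e : ℝ)⁻¹ := by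
        refine Finset.sum_le_sum fun e he => ?_
        have he0 : 0 < e := Nat.pos_of_mem_divisors he
        have hen : e ∣ n := Nat.dvd_of_mem_divisors he
        have hn0 : 0 < n := Nat.pos_of_ne_zero (Nat.mem_divisors.1 he).2
        have hq : 0 < n / e := Nat.div_pos (Nat.le_of_dvd hn0 hen) he0
        have hle : ((n / e : ℕ) : ℝ) ≤ n := by exact_mod_cast Nat.div_le_self n e
        have hq1 : (1 : ℝ) ≤ (n / e : ℕ) := by exact_mod_cast hq
        have hlog : Real.log (n / e : ℕ) ≤ Real.log n := Real.log_le_log (by linarith) hle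
        have hlog0 : 0 ≤ Real.log (n / e : ℕ) := Real.log_nonneg hq1
        have hcast : ((n / e : ℕ) : ℝ) = n * (e : ℝ)⁻¹ := by
          rw [Nat.cast_div hen (by positivity), div_eq_mul_inv]
        calc ((n / e : ℕ) : ℝ) * (((n / e : ℕ) : ℝ) ^ s * (1 + Real.log (n / e : ℕ)) ^ s)
            ≤ ((n / e : ℕ) : ℝ) * ((n : ℝ) ^ s * (1 + Real.log n) ^ s) := by gcongr
          _ = ((n : ℝ) ^ (s + 1) * (1 + Real.log n) ^ s) * (e : ℝ)⁻¹ := by rw [hcast]; ring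
    _ = ((n : ℝ) ^ (s + 1) * (1 + Real.log n) ^ s) * ∑ e ∈ n.divisors, (e : ℝ)⁻¹ := by
        rw [Finset.mul_sum]
    _ ≤ ((n : ℝ) ^ (s + 1) * (1 + Real.log n) ^ s) * (1 + Real.log n) := by
        have : 0 ≤ Real.log n := Real.log_natCast_nonneg n
        gcongr
        exact sum_divisors_inv_le n
    _ = _ := by ring

/-- The bound `n ^ s * (1 + log n) ^ s`. -/
noncomputable def powLogBound (s n : ℕ) : ℝ := (n : ℝ) ^ s * (1 + Real.log n) ^ s

theorem powLogBound_mono (s : ℕ) {m n : ℕ} (hm : m ≠ 0) (h : m ≤ n) :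
    powLogBound s m ≤ powLogBound s n := by
  have hm' : (0 : ℝ) < m := by positivity
  have h' : (m : ℝ) ≤ n := by exact_mod_cast h
  have := Real.log_le_log hm' h'
  have := Real.log_natCast_nonneg m
  unfold powLogBound
  gcongr

theorem HasSubgroupBound.cyclic_extension {G N : Type*} [Group G] [Group N] {s : ℕ}
    (hN : HasSubgroupBound N (powLogBound s))
    (ι : N →* G) [ι.range.Normal] (g : G) (hg : ∀ x : G, ∃ j : ℤ, ∃ ν : N, x = g ^ j * ι ν) :
    HasSubgroupBound G (powLogBound (s + 1)) := by
  intro n hn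
  obtain ⟨h1, h2⟩ := finite_and_subgroupCount_le_of_cyclic_extension ι g hg
    (fun m hm => (hN m hm).1) hn
  refine ⟨h1, ?_⟩
  calc (subgroupCount G n : ℝ) ≤ ∑ d ∈ n.divisors, (d : ℝ) * subgroupCount N d := by
        exact_mod_cast h2
    _ ≤ ∑ d ∈ n.divisors, (d : ℝ) * ((d : ℝ) ^ s * (1 + Real.log d) ^ s) := by
        refine Finset.sum_le_sum fun d hd => ?_
        have := (hN d (Nat.pos_of_mem_divisors hd).ne').2
        unfold powLogBound at this
        gcongr
    _ ≤ _ := sum_divisors_mul_pow_log_le s n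

/-- Viewing `ℤ` as a cyclic extension of the trivial group, only `d = 1` contributes to the divisor
sum. -/
theorem hasSubgroupBound_multiplicative_int :
    HasSubgroupBound (Multiplicative ℤ) (powLogBound 0) := by
  intro n hn
  have hfin : ∀ n : ℕ, n ≠ 0 → {L : Subgroup Unit | L.index = n}.Finite :=
    fun n _ => Set.toFinite _
  have : ((1 : Unit →* Multiplicative ℤ).range).Normal := inferInstance
  obtain ⟨h1, h2⟩ := finite_and_subgroupCount_le_of_cyclic_extension
    (1 : Unit →* Multiplicative ℤ) (Multiplicative.ofAdd 1)
    (fun x => ⟨x.toAdd, 1, by rw [← ofAdd_zsmul]; simp⟩) hfin hn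
  refine ⟨h1, ?_⟩
  have h3 : ∀ d ∈ n.divisors, d * subgroupCount Unit d = if d = 1 then 1 else 0 := by
    intro d _
    split_ifs with h
    · subst h
      simp [subgroupCount]
    · have : {L : Subgroup Unit | L.index = d} = ∅ := by
        ext L
        have : L = ⊤ := Subsingleton.elim _ _
        simp [this, Ne.symm h]
      simp [subgroupCount, this]
  rw [Finset.sum_congr rfl h3] at h2
  have h4 : subgroupCount (Multiplicative ℤ) n ≤ 1 := by
    refine h2.trans ?_
    simp [hn]
  simpa [powLogBound] using h4

theorem HasSubgroupBound.prod_int {N : Type*} [Group N] {s : ℕ}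
    (hN : HasSubgroupBound N (powLogBound s)) :
    HasSubgroupBound (N × Multiplicative ℤ) (powLogBound (s + 1)) := by
  have : (MonoidHom.inl N (Multiplicative ℤ)).range.Normal := by
    constructor
    rintro _ ⟨a, rfl⟩ ⟨x, y⟩
    exact ⟨x * a * x⁻¹, by ext <;> simp⟩
  refine hN.cyclic_extension (MonoidHom.inl N (Multiplicative ℤ)) (1, Multiplicative.ofAdd 1) ?_
  rintro ⟨a, b⟩
  refine ⟨b.toAdd, a, ?_⟩
  ext
  · simp
  · simp [← ofAdd_zsmul]

/-! ### The coordinate model and its identification with the presented group -/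

/-- The space group `P2/m` in coordinates: a translation `x ^ a * y ^ b * z ^ c` followed by
the linear part, which acts on the `x, z`-plane through the sign `ρ` and on the `y`-axis through
the sign `μ`. -/
@[ext]
structure AffineP2m where
  a : ℤ
  b : ℤ
  c : ℤ
  ρ : ℤˣ
  μ : ℤˣ

namespace AffineP2m

instance : Mul AffineP2m :=
  ⟨fun g h => ⟨g.a + g.ρ * h.a, g.b + g.μ * h.b, g.c + g.ρ * h.c, g.ρ * h.ρ, g.μ * h.μ⟩⟩

instance : One AffineP2m := ⟨⟨0, 0, 0, 1, 1⟩⟩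

instance : Inv AffineP2m :=
  ⟨fun g => ⟨-(g.ρ * g.a), -(g.μ * g.b), -(g.ρ * g.c), g.ρ, g.μ⟩⟩

@[simp] theorem mul_a (g h : AffineP2m) : (g * h).a = g.a + g.ρ * h.a := rfl
@[simp] theorem mul_b (g h : AffineP2m) : (g * h).b = g.b + g.μ * h.b := rfl
@[simp] theorem mul_c (g h : AffineP2m) : (g * h).c = g.c + g.ρ * h.c := rfl
@[simp] theorem mul_ρ (g h : AffineP2m) : (g * h).ρ = g.ρ * h.ρ := rfl
@[simp] theorem mul_μ (g h : AffineP2m) : (g * h).μ = g.μ * h.μ := rfl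
@[simp] theorem one_a : (1 : AffineP2m).a = 0 := rfl
@[simp] theorem one_b : (1 : AffineP2m).b = 0 := rfl
@[simp] theorem one_c : (1 : AffineP2m).c = 0 := rfl
@[simp] theorem one_ρ : (1 : AffineP2m).ρ = 1 := rfl
@[simp] theorem one_μ : (1 : AffineP2m).μ = 1 := rfl
@[simp] theorem inv_a (g : AffineP2m) : (g⁻¹).a = -(g.ρ * g.a) := rfl
@[simp] theorem inv_b (g : AffineP2m) : (g⁻¹).b = -(g.μ * g.b) := rfl
@[simp] theorem inv_c (g : AffineP2m) : (g⁻¹).c = -(g.ρ * g.c) := rfl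
@[simp] theorem inv_ρ (g : AffineP2m) : (g⁻¹).ρ = g.ρ := rfl
@[simp] theorem inv_μ (g : AffineP2m) : (g⁻¹).μ = g.μ := rfl

instance : Group AffineP2m :=
  Group.ofLeftAxioms
    (fun g h k => by ext <;> simp <;> ring)
    (fun g => by ext <;> simp)
    (fun g => by ext <;> simp [Int.units_mul_self])

/-- The sign of the action on the `x, z`-plane. -/
def rhoHom : AffineP2m →* ℤˣ where
  toFun := ρ
  map_one' := rfl
  map_mul' _ _ := rfl

/-- The sign of the action on the `y`-axis. -/
def muHom : AffineP2m →* ℤˣ where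
  toFun := μ
  map_one' := rfl
  map_mul' _ _ := rfl

@[simp] theorem rhoHom_apply (g : AffineP2m) : rhoHom g = g.ρ := rfl
@[simp] theorem muHom_apply (g : AffineP2m) : muHom g = g.μ := rfl

/-- The images of the generators of `P2/m`. -/
def gen : P2mGen → AffineP2m
  | .x => ⟨1, 0, 0, 1, 1⟩
  | .y => ⟨0, 1, 0, 1, 1⟩
  | .z => ⟨0, 0, 1, 1, 1⟩
  | .r => ⟨0, 0, 0, -1, 1⟩
  | .m => ⟨0, 0, 0, 1, -1⟩

theorem lift_gen_eq_one : ∀ w ∈ p2mRels, FreeGroup.lift gen w = 1 := by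
  intro w hw
  simp only [p2mRels, Set.mem_insert_iff, Set.mem_singleton_iff] at hw
  rcases hw with rfl | rfl | rfl | rfl | rfl | rfl | rfl | rfl | rfl | rfl | rfl | rfl <;>
    simp only [map_mul, map_inv, map_pow, map_commutatorElement, FreeGroup.lift_apply_of, gen] <;>
    ext <;> simp [commutatorElement_def, pow_two]

/-- The homomorphism from the presented group to the coordinate model. -/
def ofP2m : P2m →* AffineP2m := PresentedGroup.toGroup lift_gen_eq_one

@[simp] theorem ofP2m_of (t : P2mGen) : ofP2m (PresentedGroup.of t) = gen t :=
  PresentedGroup.toGroup.of lift_gen_eq_one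

end AffineP2m

namespace P2m

open P2mGen PresentedGroup

theorem mk_eq_one {w : FreeGroup P2mGen} (hw : w ∈ p2mRels) : mk p2mRels w = 1 :=
  one_of_mem hw

local notation "X" => (of x : P2m)
local notation "Y" => (of y : P2m)
local notation "Z" => (of z : P2m)
local notation "R" => (of r : P2m)
local notation "M" => (of m : P2m)

open commutatorElement in
theorem commute_of_commutator_mem {u v : P2mGen}
    (h : ⁅FreeGroup.of u, FreeGroup.of v⁆ ∈ p2mRels) : Commute (of u : P2m) (of v) := by
  have h := mk_eq_one h
  rw [map_commutatorElement] at h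
  exact commutatorElement_eq_one_iff_commute.1 h

theorem commute_x_y : Commute X Y := commute_of_commutator_mem (by simp [p2mRels])
theorem commute_x_z : Commute X Z := commute_of_commutator_mem (by simp [p2mRels])
theorem commute_y_z : Commute Y Z := commute_of_commutator_mem (by simp [p2mRels])

theorem r_mul_r : R * R = 1 := by
  have h := mk_eq_one (w := FreeGroup.of r ^ 2) (by simp [p2mRels])
  rw [map_pow, pow_two] at h
  exact h

theorem m_mul_m : M * M = 1 := by
  have h := mk_eq_one (w := FreeGroup.of m ^ 2) (by simp [p2mRels])
  rw [map_pow, pow_two] at h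
  exact h

theorem r_inv : R⁻¹ = R := inv_eq_of_mul_eq_one_left r_mul_r

theorem m_inv : M⁻¹ = M := inv_eq_of_mul_eq_one_left m_mul_m

theorem commute_m_r : Commute M R := by
  have h := mk_eq_one (w := (FreeGroup.of m * FreeGroup.of r) ^ 2) (by simp [p2mRels])
  rw [map_pow, pow_two, map_mul] at h
  have h' : M * R = (M * R)⁻¹ := eq_inv_of_mul_eq_one_left h
  rw [mul_inv_rev, r_inv, m_inv] at h'
  exact h'

theorem semiconjBy_of_conj_mem {u t : P2mGen} {e : FreeGroup P2mGen} {w : P2m}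
    (h : (FreeGroup.of t)⁻¹ * FreeGroup.of u * FreeGroup.of t * e⁻¹ ∈ p2mRels)
    (he : mk p2mRels e = w) :
    SemiconjBy (of t : P2m) w (of u) := by
  have h := mk_eq_one h
  rw [map_mul, map_inv, he, mul_inv_eq_one, map_mul, map_mul, map_inv] at h
  rw [SemiconjBy, ← h]
  change of t * ((of t)⁻¹ * of u * of t) = _
  group

theorem commute_m_x : Commute M X :=
  semiconjBy_of_conj_mem (e := FreeGroup.of x) (by simp [p2mRels]) rfl
theorem commute_m_z : Commute M Z :=
  semiconjBy_of_conj_mem (e := FreeGroup.of z) (by simp [p2mRels]) rfl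
theorem commute_r_y : Commute R Y :=
  semiconjBy_of_conj_mem (e := FreeGroup.of y) (by simp [p2mRels]) rfl
theorem semiconj_m_y : SemiconjBy M Y⁻¹ Y :=
  semiconjBy_of_conj_mem (e := (FreeGroup.of y)⁻¹) (by simp [p2mRels]) rfl
theorem semiconj_r_x : SemiconjBy R X⁻¹ X :=
  semiconjBy_of_conj_mem (e := (FreeGroup.of x)⁻¹) (by simp [p2mRels]) rfl
theorem semiconj_r_z : SemiconjBy R Z⁻¹ Z :=
  semiconjBy_of_conj_mem (e := (FreeGroup.of z)⁻¹) (by simp [p2mRels]) rfl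

/-- The normal form `x ^ a * y ^ b * z ^ c * r ^ i * m ^ j`. -/
def ofAffine (g : AffineP2m) : P2m :=
  X ^ g.a * Y ^ g.b * Z ^ g.c * (if g.ρ = 1 then 1 else R) * (if g.μ = 1 then 1 else M)

theorem ofAffine_gen_mul (t : P2mGen) (g : AffineP2m) :
    ofAffine (AffineP2m.gen t * g) = of t * ofAffine g := by
  obtain ⟨a, b, c, ρ, μ⟩ := g
  cases t
  · simp [ofAffine, AffineP2m.gen, zpow_add, mul_assoc]
  · simp only [ofAffine, AffineP2m.gen, AffineP2m.mul_a, AffineP2m.mul_b, AffineP2m.mul_c,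
      AffineP2m.mul_ρ, AffineP2m.mul_μ, Units.val_one, one_mul, zero_add, zpow_add, zpow_one]
    simp only [← mul_assoc, (commute_x_y.symm.zpow_right a).eq]
  · simp only [ofAffine, AffineP2m.gen, AffineP2m.mul_a, AffineP2m.mul_b, AffineP2m.mul_c,
      AffineP2m.mul_ρ, AffineP2m.mul_μ, Units.val_one, one_mul, zero_add, zpow_add, zpow_one]
    simp only [← mul_assoc, (commute_x_z.symm.zpow_right a).eq]
    rw [mul_assoc (X ^ a) Z (Y ^ b), (commute_y_z.symm.zpow_right b).eq]
    simp only [← mul_assoc]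
  · have hx : R * X ^ a = X ^ (-a) * R := by
      have := (semiconj_r_x.zpow_right (-a)).eq
      simpa using this
    have hz : R * Z ^ c = Z ^ (-c) * R := by
      have := (semiconj_r_z.zpow_right (-c)).eq
      simpa using this
    have hy : R * Y ^ b = Y ^ b * R := (commute_r_y.zpow_right b).eq
    have key : R * (X ^ a * Y ^ b * Z ^ c) = X ^ (-a) * Y ^ b * Z ^ (-c) * R := by
      rw [← mul_assoc, ← mul_assoc, hx, mul_assoc _ R, hy, ← mul_assoc, mul_assoc _ R, hz,
        ← mul_assoc]
    simp only [ofAffine, AffineP2m.gen, AffineP2m.mul_a, AffineP2m.mul_b, AffineP2m.mul_c,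
      AffineP2m.mul_ρ, AffineP2m.mul_μ, Units.val_one, one_mul, zero_add, Units.val_neg, neg_mul]
    rw [← mul_assoc R, ← mul_assoc R, key]
    rcases Int.units_eq_one_or ρ with rfl | rfl
    · simp
    · simp [mul_assoc, r_mul_r]
  · have hy : M * Y ^ b = Y ^ (-b) * M := by
      have := (semiconj_m_y.zpow_right (-b)).eq
      simpa using this
    have hx : M * X ^ a = X ^ a * M := (commute_m_x.zpow_right a).eq
    have hz : M * Z ^ c = Z ^ c * M := (commute_m_z.zpow_right c).eq
    have key : M * (X ^ a * Y ^ b * Z ^ c) = X ^ a * Y ^ (-b) * Z ^ c * M := by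
      rw [← mul_assoc, ← mul_assoc, hx, mul_assoc _ M, hy, ← mul_assoc, mul_assoc _ M, hz,
        ← mul_assoc]
    have hr : M * (if ρ = 1 then 1 else R) = (if ρ = 1 then 1 else R) * M := by
      split_ifs
      · simp
      · exact commute_m_r
    simp only [ofAffine, AffineP2m.gen, AffineP2m.mul_a, AffineP2m.mul_b, AffineP2m.mul_c,
      AffineP2m.mul_ρ, AffineP2m.mul_μ, Units.val_one, one_mul, zero_add, Units.val_neg, neg_mul]
    rw [← mul_assoc M, ← mul_assoc M, key, mul_assoc _ M, hr]
    rcases Int.units_eq_one_or μ with rfl | rfl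
    · simp [mul_assoc]
    · simp [mul_assoc, m_mul_m]

/-- The elements `p` satisfying this for all `g` form a subgroup, so the generators suffice. At `g =
1` it says that every element equals its normal form, which is the injectivity of `ofP2m`. -/
theorem ofAffine_ofP2m_mul (p : P2m) (g : AffineP2m) :
    ofAffine (AffineP2m.ofP2m p * g) = p * ofAffine g := by
  let S : Subgroup P2m :=
    { carrier := {p | ∀ g, ofAffine (AffineP2m.ofP2m p * g) = p * ofAffine g}
      one_mem' := fun g => by simp
      mul_mem' := fun {p q} hp hq g => by rw [map_mul, mul_assoc, hp, hq, mul_assoc]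
      inv_mem' := fun {p} hp g => by
        rw [eq_inv_mul_iff_mul_eq, ← hp, ← mul_assoc, ← map_mul, mul_inv_cancel, map_one,
          one_mul] }
  have hS : p ∈ S := generated_by p2mRels S (fun t g => by
    rw [AffineP2m.ofP2m_of, ofAffine_gen_mul]) p
  exact hS g

theorem ofAffine_ofP2m (p : P2m) : ofAffine (AffineP2m.ofP2m p) = p := by
  have := ofAffine_ofP2m_mul p 1
  simpa [ofAffine] using this

theorem ofP2m_zpow_x (n : ℤ) : AffineP2m.ofP2m (X ^ n) = ⟨n, 0, 0, 1, 1⟩ := by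
  -- A one-parameter subgroup evaluates all integer powers at once, with no induction.
  let f : Multiplicative ℤ →* AffineP2m := ⟨⟨fun n => ⟨n.toAdd, 0, 0, 1, 1⟩, rfl⟩,
    fun _ _ => by ext <;> simp⟩
  rw [map_zpow, AffineP2m.ofP2m_of]
  exact ((map_zpow f (Multiplicative.ofAdd 1) n).symm.trans (by rw [← ofAdd_zsmul]; simp [f]))

theorem ofP2m_zpow_y (n : ℤ) : AffineP2m.ofP2m (Y ^ n) = ⟨0, n, 0, 1, 1⟩ := by
  let f : Multiplicative ℤ →* AffineP2m := ⟨⟨fun n => ⟨0, n.toAdd, 0, 1, 1⟩, rfl⟩,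
    fun _ _ => by ext <;> simp⟩
  rw [map_zpow, AffineP2m.ofP2m_of]
  exact ((map_zpow f (Multiplicative.ofAdd 1) n).symm.trans (by rw [← ofAdd_zsmul]; simp [f]))

theorem ofP2m_zpow_z (n : ℤ) : AffineP2m.ofP2m (Z ^ n) = ⟨0, 0, n, 1, 1⟩ := by
  let f : Multiplicative ℤ →* AffineP2m := ⟨⟨fun n => ⟨0, 0, n.toAdd, 1, 1⟩, rfl⟩,
    fun _ _ => by ext <;> simp⟩
  rw [map_zpow, AffineP2m.ofP2m_of]
  exact ((map_zpow f (Multiplicative.ofAdd 1) n).symm.trans (by rw [← ofAdd_zsmul]; simp [f]))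

theorem ofP2m_ofAffine (g : AffineP2m) : AffineP2m.ofP2m (ofAffine g) = g := by
  obtain ⟨a, b, c, ρ, μ⟩ := g
  simp only [ofAffine, map_mul, ofP2m_zpow_x, ofP2m_zpow_y, ofP2m_zpow_z]
  rcases Int.units_eq_one_or ρ with rfl | rfl <;> rcases Int.units_eq_one_or μ with rfl | rfl <;>
    ext <;> simp [AffineP2m.gen]

/-- The presented group `P2/m` is its coordinate model. -/
def equivAffine : P2m ≃* AffineP2m where
  toFun := AffineP2m.ofP2m
  invFun := ofAffine
  left_inv := ofAffine_ofP2m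
  right_inv := ofP2m_ofAffine
  map_mul' := map_mul _

end P2m

/-! ### Transport of counts along isomorphisms and from subgroups -/

theorem image_map_setOf_index_eq {G G' : Type*} [Group G] [Group G'] (e : G ≃* G') (n : ℕ) :
    Subgroup.map (e : G →* G') '' {H : Subgroup G | H.index = n} =
      {H : Subgroup G' | H.index = n} := by
  ext H
  constructor
  · rintro ⟨K, hK, rfl⟩
    exact (Subgroup.index_map_equiv K e).trans hK
  · intro hH
    refine ⟨H.map (e.symm : G' →* G), (Subgroup.index_map_equiv H e.symm).trans hH, ?_⟩
    rw [Subgroup.map_map]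
    convert Subgroup.map_id H
    ext; simp

theorem subgroupCount_congr {G G' : Type*} [Group G] [Group G'] (e : G ≃* G') :
    subgroupCount G = subgroupCount G' := by
  funext n
  rw [subgroupCount, subgroupCount, ← image_map_setOf_index_eq e,
    Set.ncard_image_of_injective _ (Subgroup.map_injective e.injective)]

theorem HasSubgroupBound.congr {G G' : Type*} [Group G] [Group G'] (e : G ≃* G') {B : ℕ → ℝ}
    (h : HasSubgroupBound G B) : HasSubgroupBound G' B := by
  intro n hn
  rw [← subgroupCount_congr e, ← image_map_setOf_index_eq e]
  exact ⟨(h n hn).1.image _, (h n hn).2⟩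

/-- Subgroups of index `n` inside a subgroup `K` are counted in `K`. -/
theorem HasSubgroupBound.finite_and_ncard_le {G : Type*} [Group G] {K : Subgroup G} {s : ℕ}
    (hK : HasSubgroupBound K (powLogBound s)) {n : ℕ} (hn : n ≠ 0) :
    {H : Subgroup G | H.index = n ∧ H ≤ K}.Finite ∧
      ({H : Subgroup G | H.index = n ∧ H ≤ K}.ncard : ℝ) ≤ powLogBound s n := by
  -- A member `H₀` is what shows that `K.index` is nonzero and divides `n`.
  rcases Set.eq_empty_or_nonempty {H : Subgroup G | H.index = n ∧ H ≤ K} with h | ⟨H₀, hH₀, hK₀⟩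
  · rw [h]
    have : 0 ≤ powLogBound s n := by
      have := Real.log_natCast_nonneg n
      unfold powLogBound; positivity
    simpa using this
  · have hmul : ∀ H : Subgroup G, H ≤ K → (H.subgroupOf K).index * K.index = H.index :=
      fun H h => Subgroup.relIndex_mul_index h
    have hKpos : 0 < K.index := by
      rcases Nat.eq_zero_or_pos K.index with h | h
      · have := hmul H₀ hK₀
        rw [h, hH₀] at this; omega
      · exact h
    have hdvd : K.index ∣ n := ⟨_, by rw [mul_comm, hmul H₀ hK₀, hH₀]⟩
    have hne : n / K.index ≠ 0 :=
      (Nat.div_pos (Nat.le_of_dvd (Nat.pos_of_ne_zero hn) hdvd) hKpos).ne'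
    have hsub : {H : Subgroup G | H.index = n ∧ H ≤ K} ⊆
        Subgroup.map K.subtype '' {L : Subgroup K | L.index = n / K.index} := by
      rintro H ⟨h1, h2⟩
      refine ⟨H.subgroupOf K, ?_, Subgroup.map_subgroupOf_eq_of_le h2⟩
      rw [Set.mem_ofPred_eq, ← h1, ← hmul H h2, Nat.mul_div_cancel _ hKpos]
    obtain ⟨hfin, hle⟩ := hK _ hne
    refine ⟨(hfin.image _).subset hsub, ?_⟩
    calc ({H : Subgroup G | H.index = n ∧ H ≤ K}.ncard : ℝ)
        ≤ ({L : Subgroup K | L.index = n / K.index}.ncard : ℝ) := by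
          exact_mod_cast (Set.ncard_le_ncard hsub (hfin.image _)).trans (Set.ncard_image_le hfin)
      _ ≤ powLogBound s (n / K.index) := hle
      _ ≤ powLogBound s n := powLogBound_mono s hne (Nat.div_le_self _ _)

/-! ### Two-torsion in finite quotients of the lattice -/

/-- In a finite abelian group `A` there are as many solutions of `a ^ 2 = 1` as classes modulo
squares. -/
theorem card_ker_pow_two_eq_index_range {A : Type*} [CommGroup A] [Finite A] :
    Nat.card (powMonoidHom 2 : A →* A).ker = (powMonoidHom 2 : A →* A).range.index := by
  rw [Subgroup.index_range]

/-- The lattice of translations. -/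
abbrev Lattice3 : Type := (Multiplicative ℤ × Multiplicative ℤ) × Multiplicative ℤ

theorem hasSubgroupBound_lattice3 : HasSubgroupBound Lattice3 (powLogBound 2) :=
  hasSubgroupBound_multiplicative_int.prod_int.prod_int

/-- Reduction modulo 2 maps to a group of order `8`, and its kernel consists of squares. -/
theorem lattice3_index_squares :
    (powMonoidHom 2 : Lattice3 →* Lattice3).range.index ≤ 8 ∧
      (powMonoidHom 2 : Lattice3 →* Lattice3).range.index ≠ 0 := by
  let q : Multiplicative ℤ →* Multiplicative (ZMod 2) :=
    AddMonoidHom.toMultiplicative (Int.castAddHom (ZMod 2))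
  let f : Lattice3 →* (Multiplicative (ZMod 2) × Multiplicative (ZMod 2)) × Multiplicative (ZMod 2) :=
    MonoidHom.prodMap (MonoidHom.prodMap q q) q
  have hker : f.ker ≤ (powMonoidHom 2 : Lattice3 →* Lattice3).range := by
    have hq : ∀ t : Multiplicative ℤ, q t = 1 → ∃ s : Multiplicative ℤ, s ^ 2 = t := by
      intro t ht
      have h2 : ((t.toAdd : ℤ) : ZMod 2) = 0 := ht
      obtain ⟨s, hs⟩ := (ZMod.intCast_zmod_eq_zero_iff_dvd _ 2).1 h2
      refine ⟨Multiplicative.ofAdd s, ?_⟩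
      rw [← ofAdd_nsmul, nsmul_eq_mul, ← hs]; rfl
    rintro ⟨⟨a, b⟩, c⟩ h
    simp only [f, MonoidHom.mem_ker, MonoidHom.prodMap, MonoidHom.prod_apply,
      MonoidHom.comp_apply, MonoidHom.coe_fst, MonoidHom.coe_snd, Prod.mk_eq_one] at h
    obtain ⟨a', rfl⟩ := hq a h.1.1
    obtain ⟨b', rfl⟩ := hq b h.1.2
    obtain ⟨c', rfl⟩ := hq c h.2
    exact ⟨((a', b'), c'), rfl⟩
  have hkidx : f.ker.index ≤ 8 ∧ f.ker.index ≠ 0 := by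
    rw [Subgroup.index_ker]
    refine ⟨(Subgroup.card_le_card_group f.range).trans ?_, Nat.card_pos.ne'⟩
    simp
  exact ⟨(Nat.le_of_dvd (Nat.pos_of_ne_zero hkidx.2) (Subgroup.index_dvd_of_le hker)).trans hkidx.1,
    fun h => hkidx.2 (Nat.eq_zero_of_zero_dvd (h ▸ Subgroup.index_dvd_of_le hker))⟩

/-- A finite quotient of the lattice has at most `8` elements of order dividing two. -/
theorem lattice3_card_two_torsion_le (L : Subgroup Lattice3) (hL : L.index ≠ 0) :
    Finite (powMonoidHom 2 : (Lattice3 ⧸ L) →* (Lattice3 ⧸ L)).ker ∧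
      Nat.card (powMonoidHom 2 : (Lattice3 ⧸ L) →* (Lattice3 ⧸ L)).ker ≤ 8 := by
  have : Finite (Lattice3 ⧸ L) := Nat.finite_of_card_ne_zero hL
  refine ⟨inferInstance, ?_⟩
  rw [card_ker_pow_two_eq_index_range,
    ← Subgroup.index_comap_of_surjective _ (QuotientGroup.mk'_surjective L)]
  -- Squares map to squares, so the quotient has no more square classes than the lattice.
  have hle : (powMonoidHom 2 : Lattice3 →* Lattice3).range ≤
      ((powMonoidHom 2 : (Lattice3 ⧸ L) →* (Lattice3 ⧸ L)).range).comap (QuotientGroup.mk' L) := by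
    rintro _ ⟨t, rfl⟩
    exact ⟨QuotientGroup.mk' L t, rfl⟩
  exact (Nat.le_of_dvd (Nat.pos_of_ne_zero lattice3_index_squares.2)
    (Subgroup.index_dvd_of_le hle)).trans lattice3_index_squares.1

/-! ### The upper bound for `P2/m` -/

namespace AffineP2m

/-- The inclusion of the lattice of translations. -/
def translation : Lattice3 →* AffineP2m where
  toFun t := ⟨t.1.1.toAdd, t.1.2.toAdd, t.2.toAdd, 1, 1⟩
  map_one' := rfl
  map_mul' _ _ := by ext <;> simp

@[simp] theorem translation_a (t : Lattice3) : (translation t).a = t.1.1.toAdd := rfl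
@[simp] theorem translation_b (t : Lattice3) : (translation t).b = t.1.2.toAdd := rfl
@[simp] theorem translation_c (t : Lattice3) : (translation t).c = t.2.toAdd := rfl
@[simp] theorem translation_ρ (t : Lattice3) : (translation t).ρ = 1 := rfl
@[simp] theorem translation_μ (t : Lattice3) : (translation t).μ = 1 := rfl

theorem exists_translation_eq {g : AffineP2m} (h1 : g.ρ = 1) (h2 : g.μ = 1) :
    ∃ t, translation t = g :=
  ⟨((Multiplicative.ofAdd g.a, Multiplicative.ofAdd g.b), Multiplicative.ofAdd g.c), by
    ext <;> simp [h1, h2]⟩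

/-- The kernel of a sign character is an extension of its translations by at most one further
linear part. -/
theorem hasSubgroupBound_ker (χ : AffineP2m →* ℤˣ) (hχ : ∀ t, χ (translation t) = 1)
    (g₀ : AffineP2m) (hg₀ : χ g₀ = 1)
    (hgen : ∀ g, χ g = 1 → (g.ρ = 1 ∧ g.μ = 1) ∨ (g.ρ = g₀.ρ ∧ g.μ = g₀.μ)) :
    HasSubgroupBound χ.ker (powLogBound 3) := by
  let ι : Lattice3 →* χ.ker := translation.codRestrict χ.ker hχ
  have hι : ∀ g : χ.ker, g.1.ρ = 1 → g.1.μ = 1 → ∃ t, ι t = g := by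
    intro g h1 h2
    obtain ⟨t, ht⟩ := exists_translation_eq h1 h2
    exact ⟨t, Subtype.ext ht⟩
  have : ι.range.Normal := by
    constructor
    rintro _ ⟨t, rfl⟩ g
    refine hι _ ?_ ?_
    · change g.1.ρ * 1 * g.1.ρ = 1
      simp [Int.units_mul_self]
    · change g.1.μ * 1 * g.1.μ = 1
      simp [Int.units_mul_self]
  refine hasSubgroupBound_lattice3.cyclic_extension ι ⟨g₀, hg₀⟩ fun g => ?_
  rcases hgen g.1 g.2 with ⟨h1, h2⟩ | ⟨h1, h2⟩
  · obtain ⟨t, ht⟩ := hι g h1 h2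
    exact ⟨0, t, by simp [ht]⟩
  · obtain ⟨t, ht⟩ := hι (⟨g₀, hg₀⟩⁻¹ * g)
      (by change g₀.ρ * g.1.ρ = 1; rw [h1, Int.units_mul_self])
      (by change g₀.μ * g.1.μ = 1; rw [h2, Int.units_mul_self])
    exact ⟨1, t, by simp [ht]⟩

theorem hasSubgroupBound_ker_rho : HasSubgroupBound rhoHom.ker (powLogBound 3) := by
  refine hasSubgroupBound_ker rhoHom (fun t => rfl) ⟨0, 0, 0, 1, -1⟩ rfl fun g hg => ?_
  have hg : g.ρ = 1 := hg
  rcases Int.units_eq_one_or g.μ with h | h <;> simp [h, hg]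

theorem hasSubgroupBound_ker_mu : HasSubgroupBound muHom.ker (powLogBound 3) := by
  refine hasSubgroupBound_ker muHom (fun t => rfl) ⟨0, 0, 0, -1, 1⟩ rfl fun g hg => ?_
  have hg : g.μ = 1 := hg
  rcases Int.units_eq_one_or g.ρ with h | h <;> simp [h, hg]

theorem mem_ker_rho_mul_mu {g : AffineP2m} : g ∈ (rhoHom * muHom).ker ↔ g.ρ = g.μ := by
  rw [MonoidHom.mem_ker, MonoidHom.mul_apply, rhoHom_apply, muHom_apply]
  rcases Int.units_eq_one_or g.ρ with h | h <;> rcases Int.units_eq_one_or g.μ with h' | h' <;>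
    simp [h, h']

theorem hasSubgroupBound_ker_rho_mul_mu :
    HasSubgroupBound (rhoHom * muHom).ker (powLogBound 3) := by
  refine hasSubgroupBound_ker (rhoHom * muHom) (fun t => by simp) ⟨0, 0, 0, -1, -1⟩ (by simp)
    fun g hg => ?_
  have hg : g.ρ = g.μ := mem_ker_rho_mul_mu.1 hg
  rcases Int.units_eq_one_or g.μ with h | h <;> simp [h, hg]

/-- A subgroup mapping onto the whole point group contains a reflection and a point inversion. -/
theorem exists_reflection_and_inversion {H : Subgroup AffineP2m} (h1 : ¬ H ≤ rhoHom.ker)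
    (h2 : ¬ H ≤ muHom.ker) (h3 : ¬ H ≤ (rhoHom * muHom).ker) :
    (∃ g ∈ H, g.ρ = 1 ∧ g.μ = -1) ∧ (∃ s ∈ H, s.ρ = -1 ∧ s.μ = -1) := by
  obtain ⟨a, ha, ha'⟩ := SetLike.not_le_iff_exists.1 h1
  obtain ⟨b, hb, hb'⟩ := SetLike.not_le_iff_exists.1 h2
  obtain ⟨c, hc, hc'⟩ := SetLike.not_le_iff_exists.1 h3
  have ha1 : a.ρ = -1 := (Int.units_eq_one_or a.ρ).resolve_left ha'
  have hb1 : b.μ = -1 := (Int.units_eq_one_or b.μ).resolve_left hb'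
  rw [mem_ker_rho_mul_mu] at hc'
  have key : ∀ g ∈ H, ∀ s ∈ H, g.ρ = 1 → g.μ = -1 → s.ρ = -1 →
      (∃ g ∈ H, g.ρ = 1 ∧ g.μ = -1) ∧ (∃ s ∈ H, s.ρ = -1 ∧ s.μ = -1) := by
    intro g hg s hs e1 e2 e3
    refine ⟨⟨g, hg, e1, e2⟩, ?_⟩
    rcases Int.units_eq_one_or s.μ with h | h
    · exact ⟨g * s, mul_mem hg hs, by simp [e1, e3], by simp [e2, h]⟩
    · exact ⟨s, hs, e3, h⟩
  -- As `c.ρ ≠ c.μ`, either `c` already has the signs of a reflection, or it has those of the diad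
  -- rotation and then `b` or `c * b` has those of a reflection.
  rcases Int.units_eq_one_or c.ρ with hρ | hρ <;> rcases Int.units_eq_one_or c.μ with hμ | hμ
  · exact absurd (hρ.trans hμ.symm) hc'
  · exact key c hc a ha hρ hμ ha1
  · rcases Int.units_eq_one_or b.ρ with h | h
    · exact key b hb a ha h hb1 ha1
    · exact key (c * b) (mul_mem hc hb) a ha (by simp [hρ, h]) (by simp [hμ, hb1]) ha1
  · exact absurd (hρ.trans hμ.symm) hc'

/-- A subgroup containing a point inversion extends in at most eight ways by a reflection. -/
theorem finite_and_ncard_reflection_extensions_le (P : Subgroup AffineP2m) (hP : P.index ≠ 0)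
    (s : AffineP2m) (hs : s ∈ P) (hsρ : s.ρ = -1) (hsμ : s.μ = -1) :
    {H : Subgroup AffineP2m | H ⊓ (rhoHom * muHom).ker = P ∧ ∃ g ∈ H, g.ρ = 1 ∧ g.μ = -1}.Finite ∧
    {H : Subgroup AffineP2m |
      H ⊓ (rhoHom * muHom).ker = P ∧ ∃ g ∈ H, g.ρ = 1 ∧ g.μ = -1}.ncard ≤ 8 := by
  set S := {H : Subgroup AffineP2m |
      H ⊓ (rhoHom * muHom).ker = P ∧ ∃ g ∈ H, g.ρ = 1 ∧ g.μ = -1} with hS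
  -- One member `H₀` with its reflection `g₀` serves as base point; any other is recovered from the
  -- class modulo `L` of the translation between the reflections.
  rcases S.eq_empty_or_nonempty with h | ⟨H₀, hH₀, g₀, hg₀, hg₀ρ, hg₀μ⟩
  · rw [h]; simp
  set L := P.comap translation with hLdef
  have hL : L.index ≠ 0 := by
    have : P.FiniteIndex := ⟨hP⟩
    rw [hLdef, Subgroup.index_comap]
    exact (inferInstance : (P.subgroupOf translation.range).FiniteIndex).index_ne_zero
  obtain ⟨hfin, hcard⟩ := lattice3_card_two_torsion_le L hL
  let F : (powMonoidHom 2 : (Lattice3 ⧸ L) →* (Lattice3 ⧸ L)).ker → Subgroup AffineP2m :=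
    fun c => Subgroup.closure ((P : Set AffineP2m) ∪ {translation c.1.out * g₀})
  have hcomm : ∀ H ∈ S, ∀ g ∈ H, g.ρ = 1 → g.μ = -1 → g * s * g⁻¹ * s⁻¹ ∈ P := by
    intro H hH g hg e1 e2
    have hsH : s ∈ H := by
      have : s ∈ H ⊓ (rhoHom * muHom).ker := hH.1 ▸ hs
      exact this.1
    have h1 : g * s * g⁻¹ * s⁻¹ ∈ H ⊓ (rhoHom * muHom).ker :=
      Subgroup.mem_inf.2 ⟨mul_mem (mul_mem (mul_mem hg hsH) (inv_mem hg)) (inv_mem hsH), by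
        rw [mem_ker_rho_mul_mu]; simp [e1, e2, hsρ, hsμ]⟩
    rwa [hH.1] at h1
  have hsub : S ⊆ Set.range F := by
    rintro H hHS
    have hHS' := hHS
    obtain ⟨hH, g, hg, hgρ, hgμ⟩ := hHS
    obtain ⟨u, hu⟩ := exists_translation_eq (g := g * g₀⁻¹) (by simp [hgρ, hg₀ρ])
      (by simp [hgμ, hg₀μ])
    have hg' : g = translation u * g₀ := by rw [hu]; group
    -- Since `s` inverts translations, the commutator of `translation u * g₀` with `s` is that of
    -- `g₀` multiplied by `translation (u ^ 2)`. Both commutators lie in `P`.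
    have hu2 : u ^ 2 ∈ L := by
      rw [hLdef, Subgroup.mem_comap]
      have h1 := hcomm H hHS' g hg hgρ hgμ
      have h2 := hcomm H₀ ⟨hH₀, g₀, hg₀, hg₀ρ, hg₀μ⟩ g₀ hg₀ hg₀ρ hg₀μ
      have h3 := mul_mem h1 (inv_mem h2)
      have h4 : g * s * g⁻¹ * s⁻¹ * (g₀ * s * g₀⁻¹ * s⁻¹)⁻¹ = translation (u ^ 2) := by
        rw [hg']
        ext <;> simp [hg₀ρ, hg₀μ, hsρ, hsμ, pow_two] <;> ring
      rwa [h4] at h3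
    have hPH : P ≤ H := hH ▸ inf_le_left
    obtain ⟨l, hl⟩ := QuotientGroup.mk_out_eq_mul L u
    have hout : translation (QuotientGroup.mk (s := L) u).out * g₀ ∈ H := by
      have h1 : translation (QuotientGroup.mk (s := L) u).out * g₀ = translation l * g := by
        rw [hl, mul_comm u, map_mul, hg', mul_assoc]
      rw [h1]
      exact mul_mem (hPH l.2) hg
    refine ⟨⟨QuotientGroup.mk u, ?_⟩, ?_⟩
    · rw [MonoidHom.mem_ker, powMonoidHom_apply, ← QuotientGroup.mk_pow, QuotientGroup.eq_one_iff]
      exact hu2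
    · refine le_antisymm ?_ ?_
      · rw [Subgroup.closure_le]
        rintro x (hx | rfl)
        · exact hPH hx
        · exact hout
      · intro x hx
        change x ∈ Subgroup.closure
          ((P : Set AffineP2m) ∪ {translation (QuotientGroup.mk (s := L) u).out * g₀})
        set k := translation (QuotientGroup.mk (s := L) u).out * g₀ with hk
        have hkc : k ∈ Subgroup.closure ((P : Set AffineP2m) ∪ {k}) :=
          Subgroup.subset_closure (Or.inr rfl)
        by_cases hxK : x ∈ (rhoHom * muHom).ker
        · exact Subgroup.subset_closure (Or.inl (hH ▸ ⟨hx, hxK⟩ : x ∈ P))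
        · have hkx : k⁻¹ * x ∈ P := by
            rw [← hH]
            refine Subgroup.mem_inf.2 ⟨mul_mem (inv_mem hout) hx, ?_⟩
            rw [mem_ker_rho_mul_mu]
            rw [mem_ker_rho_mul_mu] at hxK
            have e1 : (k⁻¹ * x).ρ = x.ρ := by simp [hk, hg₀ρ]
            have e2 : (k⁻¹ * x).μ = -x.μ := by simp [hk, hg₀μ]
            rw [e1, e2]
            exact (Int.units_ne_iff_eq_neg.1 hxK)
          have : x = k * (k⁻¹ * x) := by group
          rw [this]
          exact mul_mem hkc (Subgroup.subset_closure (Or.inl hkx))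
  exact ⟨(Set.finite_range F).subset hsub,
    (Set.ncard_le_ncard hsub (Set.finite_range F)).trans ((Finite.card_range_le F).trans hcard)⟩

theorem index_ker_rho_mul_mu_dvd : (rhoHom * muHom).ker.index ∣ 2 := by
  rw [Subgroup.index_ker]
  have := Subgroup.card_subgroup_dvd_card (rhoHom * muHom).range
  simpa using this

/-- The subgroups of index `n` mapping onto the whole point group. -/
theorem finite_and_ncard_onto_point_group_le {n : ℕ} (hn : n ≠ 0) :
    {H : Subgroup AffineP2m | H.index = n ∧ ¬ H ≤ rhoHom.ker ∧ ¬ H ≤ muHom.ker ∧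
      ¬ H ≤ (rhoHom * muHom).ker}.Finite ∧
    ({H : Subgroup AffineP2m | H.index = n ∧ ¬ H ≤ rhoHom.ker ∧ ¬ H ≤ muHom.ker ∧
      ¬ H ≤ (rhoHom * muHom).ker}.ncard : ℝ) ≤ 8 * powLogBound 3 (2 * n) := by
  classical
  set K := (rhoHom * muHom).ker with hK
  set S := {H : Subgroup AffineP2m | H.index = n ∧ ¬ H ≤ rhoHom.ker ∧ ¬ H ≤ muHom.ker ∧
    ¬ H ≤ K} with hS
  obtain ⟨hAfin, hAle⟩ := hasSubgroupBound_ker_rho_mul_mu.finite_and_ncard_le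
    (n := 2 * n) (by omega)
  set A := {P : Subgroup AffineP2m | P.index = 2 * n ∧ P ≤ K} with hA
  -- `H` is not inside `K`, whose index divides 2, so `H ⊓ K` has index 2 in `H`; hence the `2 * n`.
  have himage : (fun H => H ⊓ K) '' S ⊆ A := by
    rintro _ ⟨H, ⟨h1, -, -, h4⟩, rfl⟩
    refine ⟨?_, inf_le_right⟩
    have hdvd : K.relIndex H ∣ 2 :=
      (Subgroup.relIndex_dvd_index_of_normal K H).trans index_ker_rho_mul_mu_dvd
    have hne : K.relIndex H ≠ 1 := fun h => h4 (Subgroup.relIndex_eq_one.1 h)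
    have h2 : K.relIndex H = 2 := ((Nat.dvd_prime Nat.prime_two).1 hdvd).resolve_left hne
    change (H ⊓ K).index = _
    rw [← Subgroup.relIndex_mul_index (inf_le_left : H ⊓ K ≤ H), Subgroup.inf_relIndex_left,
      h2, h1]
  have hfib : ∀ P ∈ (fun H => H ⊓ K) '' S,
      {H | H ∈ S ∧ H ⊓ K = P}.Finite ∧ {H | H ∈ S ∧ H ⊓ K = P}.ncard ≤ 8 := by
    rintro P ⟨H, hH, rfl⟩
    obtain ⟨-, s, hs, hsρ, hsμ⟩ := exists_reflection_and_inversion hH.2.1 hH.2.2.1 hH.2.2.2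
    have hPidx : (H ⊓ K).index ≠ 0 := by
      have : (H ⊓ K).index = 2 * n := (himage ⟨H, hH, rfl⟩).1
      omega
    obtain ⟨hf, hc⟩ := finite_and_ncard_reflection_extensions_le (H ⊓ K) hPidx s
      (Subgroup.mem_inf.2 ⟨hs, by rw [hK, mem_ker_rho_mul_mu, hsρ, hsμ]⟩) hsρ hsμ
    have hsub : {H' | H' ∈ S ∧ H' ⊓ K = H ⊓ K} ⊆ {H' : Subgroup AffineP2m |
        H' ⊓ (rhoHom * muHom).ker = H ⊓ K ∧ ∃ g ∈ H', g.ρ = 1 ∧ g.μ = -1} :=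
      fun H' hH' => ⟨hH'.2,
        (exists_reflection_and_inversion hH'.1.2.1 hH'.1.2.2.1 hH'.1.2.2.2).1⟩
    exact ⟨hf.subset hsub, (Set.ncard_le_ncard hsub hf).trans hc⟩
  have hSfin : S.Finite := Set.Finite.of_finite_fibers (fun H => H ⊓ K) (hAfin.subset himage)
    fun P hP => (hfib P hP).1
  refine ⟨hSfin, ?_⟩
  have hcard : S.ncard ≤ 8 * A.ncard := by
    rw [Set.ncard_eq_toFinset_card S hSfin]
    refine (Finset.card_le_mul_card_image (f := fun H => H ⊓ K) hSfin.toFinset 8 ?_).trans ?_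
    · intro P hP
      have hP' : P ∈ (fun H => H ⊓ K) '' S := by simpa using hP
      refine le_trans (le_of_eq ?_) (hfib P hP').2
      rw [← Set.ncard_coe_finset]
      congr 1
      ext H; simp
    · refine Nat.mul_le_mul_left 8 ?_
      rw [← Set.ncard_coe_finset, Finset.coe_image, hSfin.coe_toFinset]
      exact Set.ncard_le_ncard himage hAfin
  calc (S.ncard : ℝ) ≤ 8 * A.ncard := by exact_mod_cast hcard
    _ ≤ 8 * powLogBound 3 (2 * n) := by gcongr

/-- The constant is `11 = 3 + 8`: one for each sign kernel, and eight for the subgroups mapping onto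
the point group. -/
theorem hasSubgroupBound : HasSubgroupBound AffineP2m fun n => 11 * powLogBound 3 (2 * n) := by
  intro n hn
  obtain ⟨f1, c1⟩ := hasSubgroupBound_ker_rho.finite_and_ncard_le hn
  obtain ⟨f2, c2⟩ := hasSubgroupBound_ker_mu.finite_and_ncard_le hn
  obtain ⟨f3, c3⟩ := hasSubgroupBound_ker_rho_mul_mu.finite_and_ncard_le hn
  obtain ⟨f4, c4⟩ := finite_and_ncard_onto_point_group_le hn
  set S1 := {H : Subgroup AffineP2m | H.index = n ∧ H ≤ rhoHom.ker}
  set S2 := {H : Subgroup AffineP2m | H.index = n ∧ H ≤ muHom.ker}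
  set S3 := {H : Subgroup AffineP2m | H.index = n ∧ H ≤ (rhoHom * muHom).ker}
  set S4 := {H : Subgroup AffineP2m | H.index = n ∧ ¬ H ≤ rhoHom.ker ∧ ¬ H ≤ muHom.ker ∧
      ¬ H ≤ (rhoHom * muHom).ker}
  have hsub : {H : Subgroup AffineP2m | H.index = n} ⊆ ((S1 ∪ S2) ∪ S3) ∪ S4 := by
    intro H hH
    have hH : H.index = n := hH
    by_cases h1 : H ≤ rhoHom.ker
    · exact Or.inl (Or.inl (Or.inl ⟨hH, h1⟩))
    by_cases h2 : H ≤ muHom.ker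
    · exact Or.inl (Or.inl (Or.inr ⟨hH, h2⟩))
    by_cases h3 : H ≤ (rhoHom * muHom).ker
    · exact Or.inl (Or.inr ⟨hH, h3⟩)
    exact Or.inr ⟨hH, h1, h2, h3⟩
  have hfin := ((f1.union f2).union f3).union f4
  refine ⟨hfin.subset hsub, ?_⟩
  have hle : subgroupCount AffineP2m n ≤ S1.ncard + S2.ncard + S3.ncard + S4.ncard := by
    refine (Set.ncard_le_ncard hsub hfin).trans ?_
    have := Set.ncard_union_le ((S1 ∪ S2) ∪ S3) S4
    have := Set.ncard_union_le (S1 ∪ S2) S3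
    have := Set.ncard_union_le S1 S2
    omega
  have hle' : (subgroupCount AffineP2m n : ℝ) ≤ S1.ncard + S2.ncard + S3.ncard + S4.ncard := by
    exact_mod_cast hle
  have := powLogBound_mono 3 hn (by omega : n ≤ 2 * n)
  linarith

end AffineP2m

/-! ### Dihedral quotients and the lower bound -/

/-- A sign `χ` and a `χ`-twisted cocycle with values in `ZMod k` define a homomorphism to the
dihedral group. -/
def MonoidHom.toDihedral {G : Type*} [Group G] {k : ℕ} (χ : G →* ℤˣ) (l : G → ZMod k)
    (hl : ∀ g h, l (g * h) = l g + ((χ g : ℤ) : ZMod k) * l h) : G →* DihedralGroup k :=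
  -- The sign in `sr (-l g)` matches the convention `r i * sr j = sr (j - i)`.
  MonoidHom.mk' (fun g => if χ g = 1 then DihedralGroup.r (l g) else DihedralGroup.sr (-l g)) <| by
    intro g h
    rcases Int.units_eq_one_or (χ g) with e | e <;> rcases Int.units_eq_one_or (χ h) with e' | e' <;>
      simp [hl, e, e'] <;> ring

section toDihedral

variable {G : Type*} [Group G] {k : ℕ} {χ : G →* ℤˣ} {l : G → ZMod k}
  (hl : ∀ g h, l (g * h) = l g + ((χ g : ℤ) : ZMod k) * l h)

theorem MonoidHom.toDihedral_apply (g : G) :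
    χ.toDihedral l hl g = if χ g = 1 then DihedralGroup.r (l g) else DihedralGroup.sr (-l g) :=
  rfl

theorem MonoidHom.toDihedral_surjective (h1 : ∀ i, ∃ g, χ g = 1 ∧ l g = i)
    (h2 : ∀ i, ∃ g, χ g = -1 ∧ l g = i) : Function.Surjective (χ.toDihedral l hl) := by
  rintro (i | i)
  · obtain ⟨g, e, rfl⟩ := h1 i
    exact ⟨g, by simp [MonoidHom.toDihedral_apply, e]⟩
  · obtain ⟨g, e, h⟩ := h2 (-i)
    exact ⟨g, by simp [MonoidHom.toDihedral_apply, e, h]⟩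

end toDihedral

theorem DihedralGroup.index_zpowers_sr {k : ℕ} [NeZero k] (t : ZMod k) :
    (Subgroup.zpowers (DihedralGroup.sr t)).index = k := by
  have h := (Subgroup.zpowers (DihedralGroup.sr t)).index_mul_card
  rw [Nat.card_zpowers, DihedralGroup.orderOf_sr, DihedralGroup.nat_card] at h
  omega

theorem DihedralGroup.r_mem_zpowers_sr {k : ℕ} {i t : ZMod k} :
    DihedralGroup.r i ∈ Subgroup.zpowers (DihedralGroup.sr t) ↔ i = 0 := by
  constructor
  · rintro ⟨j, hj⟩
    simp only at hj
    rcases Int.even_or_odd' j with ⟨q, rfl | rfl⟩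
    · rw [zpow_mul] at hj
      have h2 : (DihedralGroup.sr t) ^ (2 : ℤ) = 1 := by
        rw [zpow_two, DihedralGroup.sr_mul_self]
      rw [h2, one_zpow, DihedralGroup.one_def] at hj
      exact (DihedralGroup.r.inj hj).symm
    · have h2 : (DihedralGroup.sr t) ^ (2 : ℤ) = 1 := by
        rw [zpow_two, DihedralGroup.sr_mul_self]
      rw [zpow_add, zpow_mul, h2, one_zpow, one_mul, zpow_one] at hj
      exact DihedralGroup.noConfusion rfl (heq_of_eq hj)
  · rintro rfl
    exact one_mem _

theorem DihedralGroup.sr_mem_zpowers_sr {k : ℕ} {i t : ZMod k} :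
    DihedralGroup.sr i ∈ Subgroup.zpowers (DihedralGroup.sr t) ↔ i = t := by
  constructor
  · intro h
    have h2 := mul_mem h (Subgroup.mem_zpowers (DihedralGroup.sr t))
    rw [DihedralGroup.sr_mul_sr, DihedralGroup.r_mem_zpowers_sr] at h2
    exact (sub_eq_zero.1 h2).symm
  · rintro rfl
    exact Subgroup.mem_zpowers _

namespace AffineP2m

/-- The action on the `y`-axis maps onto the dihedral group of order `2n`, where a reflection
generates a subgroup of index `n`. -/
theorem exists_index_eq (n : ℕ) [NeZero n] : ∃ H : Subgroup AffineP2m, H.index = n := by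
  let f := muHom.toDihedral (fun g => (g.b : ZMod n)) (fun g h => by simp)
  have hf : Function.Surjective f := by
    refine MonoidHom.toDihedral_surjective _ (fun i => ?_) (fun i => ?_)
    · obtain ⟨j, rfl⟩ := ZMod.intCast_surjective i
      exact ⟨⟨0, j, 0, 1, 1⟩, rfl, rfl⟩
    · obtain ⟨j, rfl⟩ := ZMod.intCast_surjective i
      exact ⟨⟨0, j, 0, 1, -1⟩, rfl, rfl⟩
  exact ⟨(Subgroup.zpowers (DihedralGroup.sr 0)).comap f, by
    rw [Subgroup.index_comap_of_surjective _ hf, DihedralGroup.index_zpowers_sr]⟩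

/-- The action of the translations and point inversions on `ℤ³` modulo the lattice
`c = p a + q b` of index `k`. -/
def quotientDihedral {k : ℕ} (p q : ZMod k) : (rhoHom * muHom).ker →* DihedralGroup k :=
  (rhoHom.comp (rhoHom * muHom).ker.subtype).toDihedral
    (fun g => (g.1.c : ZMod k) - p * (g.1.a : ZMod k) - q * (g.1.b : ZMod k)) (by
      -- On this kernel `ρ = μ`, so all coordinates are twisted by the same sign and any linear form
      -- in them is a cocycle.
      rintro ⟨g, hg⟩ ⟨h, hh⟩
      have := mem_ker_rho_mul_mu.1 hg
      simp [← this]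
      ring)

theorem quotientDihedral_apply {k : ℕ} (p q : ZMod k) (g : (rhoHom * muHom).ker) :
    quotientDihedral p q g = if g.1.ρ = 1 then
      DihedralGroup.r ((g.1.c : ZMod k) - p * (g.1.a : ZMod k) - q * (g.1.b : ZMod k)) else
      DihedralGroup.sr (-((g.1.c : ZMod k) - p * (g.1.a : ZMod k) - q * (g.1.b : ZMod k))) := rfl

theorem quotientDihedral_surjective {k : ℕ} (p q : ZMod k) :
    Function.Surjective (quotientDihedral p q) := by
  refine MonoidHom.toDihedral_surjective _ (fun i => ?_) (fun i => ?_)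
  · obtain ⟨j, rfl⟩ := ZMod.intCast_surjective i
    exact ⟨⟨⟨0, 0, j, 1, 1⟩, mem_ker_rho_mul_mu.2 rfl⟩, rfl, by simp⟩
  · obtain ⟨j, rfl⟩ := ZMod.intCast_surjective i
    exact ⟨⟨⟨0, 0, j, -1, -1⟩, mem_ker_rho_mul_mu.2 rfl⟩, rfl, by simp⟩

theorem index_ker_rho_mul_mu : (rhoHom * muHom).ker.index = 2 := by
  refine ((Nat.dvd_prime Nat.prime_two).1 index_ker_rho_mul_mu_dvd).resolve_left fun h => ?_
  rw [Subgroup.index_eq_one] at h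
  have h1 : (⟨0, 0, 0, 1, -1⟩ : AffineP2m) ∈ (rhoHom * muHom).ker := h ▸ Subgroup.mem_top _
  rw [mem_ker_rho_mul_mu] at h1
  exact absurd h1 (by decide)

/-- A family of subgroups of index `2 * k`: a lattice of index `k` with a class of inversion
centres. -/
def inversionSubgroup {k : ℕ} (v : ZMod k × ZMod k × ZMod k) : Subgroup (rhoHom * muHom).ker :=
  (Subgroup.zpowers (DihedralGroup.sr v.2.2)).comap (quotientDihedral v.1 v.2.1)

/-- The parameters can be read off: the translation `(1, 0, c)` belongs exactly when `c = p`, `(0,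
1, c)` exactly when `c = q`, and the inversion with translation part `(0, 0, c)` exactly when `-c =
t`, all modulo `k`. -/
theorem inversionSubgroup_injective {k : ℕ} :
    Function.Injective (inversionSubgroup (k := k)) := by
  rintro ⟨p, q, t⟩ ⟨p', q', t'⟩ h
  have hlat : ∀ a b c : ℤ,
      ((c : ZMod k) - p * a - q * b = 0 ↔ (c : ZMod k) - p' * a - q' * b = 0) := by
    intro a b c
    have h1 := SetLike.ext_iff.1 h ⟨⟨a, b, c, 1, 1⟩, mem_ker_rho_mul_mu.2 rfl⟩
    simpa [inversionSubgroup, quotientDihedral_apply, DihedralGroup.r_mem_zpowers_sr] using h1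
  have hinv : ∀ c : ℤ, (-(c : ZMod k) = t ↔ -(c : ZMod k) = t') := by
    intro c
    have h1 := SetLike.ext_iff.1 h ⟨⟨0, 0, c, -1, -1⟩, mem_ker_rho_mul_mu.2 rfl⟩
    simpa [inversionSubgroup, quotientDihedral_apply, DihedralGroup.sr_mem_zpowers_sr] using h1
  obtain ⟨a, ha⟩ := ZMod.intCast_surjective p
  obtain ⟨b, hb⟩ := ZMod.intCast_surjective q
  obtain ⟨c, hc⟩ := ZMod.intCast_surjective (-t)
  have e1 : p = p' := by
    have := (hlat 1 0 a).1 (by simp [ha])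
    simpa [ha, sub_eq_zero] using this
  have e2 : q = q' := by
    have := (hlat 0 1 b).1 (by simp [hb])
    simpa [hb, sub_eq_zero] using this
  have e3 : t = t' := by
    have := (hinv c).1 (by simp [hc])
    simpa [hc] using this
  rw [e1, e2, e3]

theorem pow_three_le_subgroupCount (k : ℕ) [NeZero k] :
    k ^ 3 ≤ subgroupCount AffineP2m (2 * k) := by
  let F : ZMod k × ZMod k × ZMod k → Subgroup AffineP2m := fun v =>
    (inversionSubgroup v).map (rhoHom * muHom).ker.subtype
  have hF : Function.Injective F :=
    (Subgroup.map_injective (Subgroup.subtype_injective _)).comp inversionSubgroup_injective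
  have hsub : Set.range F ⊆ {H : Subgroup AffineP2m | H.index = 2 * k} := by
    rintro _ ⟨v, rfl⟩
    change Subgroup.index (Subgroup.map _ _) = _
    rw [Subgroup.index_map_subtype, index_ker_rho_mul_mu, inversionSubgroup,
      Subgroup.index_comap_of_surjective _ (quotientDihedral_surjective _ _),
      DihedralGroup.index_zpowers_sr, mul_comm]
  have hk : k ≠ 0 := NeZero.ne k
  calc k ^ 3 = (Set.range F).ncard := by
        rw [← Set.image_univ, Set.ncard_image_of_injective _ hF, Set.ncard_univ]
        simp; ring
    -- Finiteness from the upper bound is essential, as `ncard` of an infinite set is 0.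
    _ ≤ _ := Set.ncard_le_ncard hsub (hasSubgroupBound (2 * k) (by omega)).1

end AffineP2m

/-! ### From counts to the degree -/

theorem subgroupCount_p2m : subgroupCount P2m = subgroupCount AffineP2m :=
  subgroupCount_congr P2m.equivAffine

theorem hasSubgroupBound_p2m : HasSubgroupBound P2m fun n => 11 * powLogBound 3 (2 * n) :=
  AffineP2m.hasSubgroupBound.congr P2m.equivAffine.symm

/-- A polynomial upper bound of exponent `s` bounds the degree by `s`. -/
theorem subgroupGrowthDegree_le_of_isBigO {G : Type*} [Group G] {s : ℝ} (hs : 0 ≤ s)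
    (h : (fun n : ℕ => (subgroupCount G n : ℝ)) =O[atTop] (fun n : ℕ => (n : ℝ) ^ s)) :
    subgroupGrowthDegree G ≤ (s : EReal) := by
  obtain ⟨C, hC1, hC⟩ := h.exists_pos
  have hlim : Tendsto (fun n : ℕ => ((|Real.log C| / Real.log n + s : ℝ) : EReal)) atTop
      (𝓝 (s : EReal)) := by
    rw [EReal.tendsto_coe]
    have h1 : Tendsto (fun n : ℕ => |Real.log C| / Real.log n) atTop (𝓝 0) :=
      (Real.tendsto_log_atTop.comp tendsto_natCast_atTop_atTop).const_div_atTop _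
    simpa using h1.add_const s
  rw [subgroupGrowthDegree, ← hlim.limsup_eq]
  refine limsup_le_limsup ?_
  filter_upwards [hC.bound, eventually_ge_atTop 2] with n hn hn2
  rw [EReal.coe_le_coe_iff]
  have hn1 : (1 : ℝ) < n := by exact_mod_cast hn2
  have hlog : 0 < Real.log n := Real.log_pos hn1
  have hpow : 0 < (n : ℝ) ^ s := Real.rpow_pos_of_pos (by linarith) s
  rw [Real.norm_of_nonneg (Nat.cast_nonneg _), Real.norm_of_nonneg hpow.le] at hn
  rw [div_add' _ _ _ hlog.ne', div_le_div_iff_of_pos_right hlog]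
  -- A zero count gives `Real.log 0 = 0`, and `0 ≤ s` settles that case.
  rcases Nat.eq_zero_or_pos (subgroupCount G n) with h0 | h0
  · rw [h0]
    simp only [Nat.cast_zero, Real.log_zero]
    positivity
  · have h0' : (0 : ℝ) < subgroupCount G n := by exact_mod_cast h0
    calc Real.log (subgroupCount G n) ≤ Real.log (C * (n : ℝ) ^ s) := Real.log_le_log h0' hn
      _ = Real.log C + s * Real.log n := by
        rw [Real.log_mul hC1.ne' hpow.ne', Real.log_rpow (by linarith)]
      _ ≤ |Real.log C| + s * Real.log n := by gcongr; exact le_abs_self _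

theorem isBigO_subgroupCount_p2m {ε : ℝ} (hε : 0 < ε) :
    (fun n : ℕ => (subgroupCount P2m n : ℝ)) =O[atTop] (fun n : ℕ => (n : ℝ) ^ (3 + ε)) := by
  have h1 : (fun n : ℕ => (subgroupCount P2m n : ℝ)) =O[atTop]
      (fun n : ℕ => (n : ℝ) ^ 3 * (1 + Real.log (2 * n)) ^ 3) := by
    -- `88 = 11 * 2 ^ 3`, the cube coming from the argument `2 * n`.
    refine IsBigO.of_bound 88 ?_
    filter_upwards [eventually_ge_atTop 1] with n hn
    have hb := (hasSubgroupBound_p2m n (by omega)).2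
    have hlog : 0 ≤ Real.log (2 * n) := by
      have := Real.log_natCast_nonneg (2 * n)
      push_cast at this; exact this
    rw [Real.norm_of_nonneg (Nat.cast_nonneg _), Real.norm_of_nonneg (by positivity)]
    refine hb.trans (le_of_eq ?_)
    unfold powLogBound
    push_cast; ring
  refine h1.trans ?_
  -- Three logarithmic factors share the exponent `ε` equally.
  have hlog : (fun x : ℝ => 1 + Real.log (2 * x)) =O[atTop] fun x : ℝ => x ^ (ε / 3) := by
    have hl : Real.log =O[atTop] fun x : ℝ => x ^ (ε / 3) :=
      (isLittleO_log_rpow_atTop (by positivity)).isBigO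
    have hone : ∀ c : ℝ, (fun _ : ℝ => c) =O[atTop] fun x : ℝ => x ^ (ε / 3) := fun c =>
      ((isLittleO_const_left.2 (Or.inr (tendsto_norm_atTop_atTop.comp
        (tendsto_rpow_atTop (by positivity))))).isBigO)
    refine ((hone (1 + Real.log 2)).add hl).congr' ?_ EventuallyEq.rfl
    filter_upwards [eventually_gt_atTop 0] with x hx
    rw [Real.log_mul (by norm_num) hx.ne']; ring
  have hlogn := (hlog.comp_tendsto tendsto_natCast_atTop_atTop).pow 3
  refine ((isBigO_refl (fun n : ℕ => (n : ℝ) ^ 3) atTop).mul hlogn).congr'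
    EventuallyEq.rfl ?_
  filter_upwards [eventually_gt_atTop 0] with n hn
  have hn' : (0 : ℝ) < n := by exact_mod_cast hn
  simp only [Function.comp_apply]
  rw [← Real.rpow_natCast ((n : ℝ) ^ (ε / 3)) 3, ← Real.rpow_mul hn'.le, Real.rpow_add hn',
    ← Real.rpow_natCast]
  norm_num

/-- Even indices suffice: `a_{2k} ≥ k³`, and `log k³ / log 2k = 3 - 3 log 2 / log 2k` tends to 3. -/
theorem three_le_subgroupGrowthDegree_p2m : (3 : EReal) ≤ subgroupGrowthDegree P2m := by
  set u : ℕ → EReal := fun n =>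
    ((Real.log (subgroupCount P2m n) / Real.log n : ℝ) : EReal) with hu
  have hcast : Tendsto (fun k : ℕ => (2 * k : ℕ)) atTop atTop :=
    tendsto_id.const_mul_atTop' (by norm_num)
  have hsub : limsup (u ∘ fun k : ℕ => 2 * k) atTop ≤ limsup u atTop := by
    rw [limsup_comp]
    exact limsup_le_limsup_of_le hcast
  refine le_trans ?_ hsub
  have hlim : Tendsto (fun k : ℕ => ((3 - 3 * Real.log 2 / Real.log (2 * k : ℕ) : ℝ) : EReal)) atTop
      (𝓝 (3 : EReal)) := by
    have : (3 : EReal) = ((3 : ℝ) : EReal) := rfl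
    rw [this, EReal.tendsto_coe]
    have h1 : Tendsto (fun k : ℕ => 3 * Real.log 2 / Real.log (2 * k : ℕ)) atTop (𝓝 0) :=
      (Real.tendsto_log_atTop.comp (tendsto_natCast_atTop_atTop.comp hcast)).const_div_atTop _
    simpa using h1.const_sub 3
  rw [← hlim.limsup_eq]
  refine limsup_le_limsup ?_
  filter_upwards [eventually_ge_atTop 1] with k hk
  have : NeZero k := ⟨by omega⟩
  have hk0 : (0 : ℝ) < k := by exact_mod_cast hk
  have hlog : 0 < Real.log (2 * k : ℕ) := Real.log_pos (by
    have : 1 < 2 * k := by omega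
    exact_mod_cast this)
  simp only [hu, Function.comp_apply]
  rw [EReal.coe_le_coe_iff, subgroupCount_p2m, sub_div' hlog.ne', div_le_div_iff_of_pos_right hlog]
  have hle : ((k : ℝ)) ^ 3 ≤ subgroupCount AffineP2m (2 * k) := by
    exact_mod_cast AffineP2m.pow_three_le_subgroupCount k
  calc 3 * Real.log (2 * k : ℕ) - 3 * Real.log 2 = Real.log ((k : ℝ) ^ 3) := by
        push_cast
        rw [Real.log_mul (by norm_num) hk0.ne', Real.log_pow]; push_cast; ring
    _ ≤ _ := Real.log_le_log (by positivity) hle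

theorem proposition4p3 :
    (∀ n : ℕ, 1 ≤ n →
      {H : Subgroup P2m | H.index = n}.Finite ∧ {H : Subgroup P2m | H.index = n}.Nonempty) ∧
    subgroupGrowthDegree P2m = 3 ∧
    IsLeast
      {c : ℝ | 0 < c ∧ ∀ ε : ℝ, 0 < ε →
        (fun n : ℕ => (subgroupCount P2m n : ℝ)) =O[atTop] (fun n : ℕ => (n : ℝ) ^ (c + ε))}
      3 := by
  refine ⟨fun n hn => ⟨(hasSubgroupBound_p2m n (by omega)).1, ?_⟩, le_antisymm ?_
    three_le_subgroupGrowthDegree_p2m, ⟨by norm_num, fun ε hε => isBigO_subgroupCount_p2m hε⟩, ?_⟩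
  · have : NeZero n := ⟨by omega⟩
    obtain ⟨H, hH⟩ := AffineP2m.exists_index_eq n
    rw [← image_map_setOf_index_eq P2m.equivAffine.symm]
    exact Set.Nonempty.image _ ⟨H, hH⟩
  · refine EReal.le_of_forall_lt_iff_le.1 fun z hz => ?_
    have hz : (3 : ℝ) < z := EReal.coe_lt_coe_iff.1 hz
    have h := subgroupGrowthDegree_le_of_isBigO (by linarith)
      (isBigO_subgroupCount_p2m (sub_pos.2 hz))
    simpa using h
  -- An admissible `c` bounds the degree by `c + ε` for every `ε > 0`, while the degree is at least
  -- 3.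
  · rintro c ⟨hc, h⟩
    refine le_of_forall_pos_le_add fun ε hε => ?_
    have := three_le_subgroupGrowthDegree_p2m.trans
      (subgroupGrowthDegree_le_of_isBigO (by linarith) (h ε hε))
    exact EReal.coe_le_coe_iff.1 this
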